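/- **Data generating process.** Let $n,d\in\mathbb N$ and let $U$ be a set of domains. A *model* $(g,f,p_Z,\Theta)$ consists of (i) an acyclic structural equation model $Z_i=f_i(\mathrm{PA}(Z_i),\epsilon_i;\theta_i)$, $i=1,\dots,n$, with measurable $f_i$, mutually independent real noises $\epsilon_i$ and latent factors $\theta^{(u)}=(\theta^{(u)}_1,\dots,\theta^{(u)}_n)$, $u\in U$ (so $\Theta=\{\theta^{(u)}\}_{u\in U}$), such that in each domain $u$ the law of $Z=(Z_1,\dots,Z_n)$ has a density $p_Z(\cdot;\theta^{(u)})$ on $\mathbb R^n$; and (ii) a mixing function $g:\mathbb R^n\to\mathbb R^d$ that is a $C^2$-diffeomorphism onto its image, with $X=g(Z)$. The density of $X$ (with respect to $n$-dimensional volume on the image of $g$) is $p_X(g(z);\theta)=p_Z(z;\theta)/\sqrt{\det(J_g(z)^{T}J_g(z))}$, and $p_X=0$ off the image of $g$. The Markov network $\mathcal M_Z$ is the simple graph on $\{Z_1,\dots,Z_n\}$ in which distinct $Z_i,Z_j$ are non-adjacent if and only if $Z_i$ and $Z_j$ are conditionally independent given all the remaining variables in every domain; $|\mathcal M_Z|$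 is its number of edges. The set of intimate neighbors of $Z_i$ is $$\Psi_{Z_i}=\{Z_j : j\ne i,\ Z_j\text{ is adjacent in }\mathcal M_Z\text{ to }Z_i\text{ and to all other neighbors of }Z_i\}.$$ **Assumptions on the true model** $(g,f,p_Z,\Theta)$. * A1 (smooth and positive density): for every $u$, $p_Z(\cdot;\theta^{(u)})$ is twice continuously differentiable and positive on $\mathbb R^n$. * A2 (sufficient changes): for each $z\in\mathbb R^n$ there are $2n+|\mathcal M_Z|+1$ values $\theta^{(0)},\dots,\theta^{(2n+|\mathcal M_Z|)}\in\Theta$ such that the vectors $w(z,k)-w(z,0)$, $k=1,\dots,2n+|\mathcal M_Z|$, are linearly independent, where $$w(z,k)=\Big(\tfrac{\partial\log p_Z(z;\theta^{(k)})}{\partial z_i}\Big)_{i}\oplus\Big(\tfrac{\partial^2\log p_Z(z;\theta^{(k)})}{\partial z_i^2}\Big)_{i}\oplus\Big(\tfrac{\partial^2\log p_Z(z;\theta^{(k)})}{\partial z_i\partial z_j}\Big)_{i<j,\ \{Z_i,Z_j\}\in\mathcal E(\mathcal M_Z)} .$$ **Estimation.** Let $(\hat g,\hat f,p_{\hat Z},\hat\Theta)$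 be a model with the same $n$, $d$ and $U$ that matches the distribution of $X$, i.e. $p_X(x;\theta^{(u)})=p_{\hat X}(x;\hat\theta^{(u)})$ for all $u\in U$ and all $x$ in the image of $g$, and whose Markov network $\mathcal M_{\hat Z}$ has the minimal number of edges among all models (with the same $n,d,U$) that match it. **Theorem (Identifiability of latent causal variables).** The estimated latent variables are a well-defined function of the true ones, i.e. for every $z\in\mathbb R^n$ there is a $\hat Z(z)\in\mathbb R^n$ with $\hat g(\hat Z(z))=g(z)$. There is a permutation $\pi$ of $\{1,\dots,n\}$ such that for each $i$: 1. $\hat Z_{\pi(i)}$ is solely a function of $Z_i$ and the variables in $\Psi_{Z_i}$: $\hat Z_{\pi(i)}(z)$ depends only on the coordinates of $z$ belonging to $\{Z_i\}\cup\Psi_{Z_i}$; 2. $\hat Z_{\pi(i)}$ does depend on $Z_i$: for some $z$, changing only the $i$-th coordinate of $z$ changes $\hat Z_{\pi(i)}(z)$; 3. if $\Psi_{Z_i}=\varnothing$, then $Z_i$ is recovered up to a component-wise transformation: $\hat Z_{\pi(i)}(z)=h(z_i)$ for all $z$, for some $C^2$-diffeomorphism $h$ of $\mathbb R$ onto its image.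 -/

import Mathlib

open MeasureTheory ProbabilityTheory

noncomputable section

namespace CausalRep

universe v

/-- `g` is a `C²`-diffeomorphism onto its image: it is `C²`, and it has an inverse, defined on the
image, which is `C²` as well. (In particular `g` is injective, an immersion and a homeomorphism
onto its image.) -/
def IsC2DiffeoOntoImage {E F : Type*} [NormedAddCommGroup E] [NormedSpace ℝ E]
    [NormedAddCommGroup F] [NormedSpace ℝ F] (g : E → F) : Prop :=
  ContDiff ℝ 2 g ∧
    ∃ ginv : F → E, ContDiffOn ℝ 2 ginv (Set.range g) ∧ Function.LeftInverse ginv g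

/-- A latent structural equation model
`Z i = f i (PA (Z i), ε i; θ i)`, `i = 1, …, n`, over domains `u : U`.
The graph `j → i` (`parent j i`) is acyclic, the noises `ε i` are mutually independent real random
variables with laws `noise i`, and only the factor `θ u = (θ u 1, …, θ u n)` depends on
the domain `u`. -/
structure LatentSEM (n : ℕ) (U : Type v) where
  parent : Fin n → Fin n → Prop
  acyclic : ∀ i, ¬ Relation.TransGen parent i i
  Par : Fin n → Type v
  θ : U → (i : Fin n) → Par i
  f : (i : Fin n) → ({j : Fin n // parent j i} → ℝ) → ℝ → Par i → ℝ
  f_measurable : ∀ (i : Fin n) (t : Par i),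
    Measurable fun q : ({j : Fin n // parent j i} → ℝ) × ℝ => f i q.1 q.2 t
  noise : Fin n → Measure ℝ
  noise_prob : ∀ i, IsProbabilityMeasure (noise i)

namespace LatentSEM

variable {n : ℕ} {U : Type v} (S : LatentSEM n U)

theorem parent_wf : WellFounded S.parent := by
  have : IsTrans (Fin n) (Relation.TransGen S.parent) := ⟨fun _ _ _ h h' => h.trans h'⟩
  have : Std.Irrefl (Relation.TransGen S.parent) := ⟨S.acyclic⟩
  exact Subrelation.wf (fun h => Relation.TransGen.single h)
    (Finite.wellFounded_of_trans_of_irrefl (Relation.TransGen S.parent))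

/-- The solution `Z` of the structural equations in domain `u`, as a function of the noise. -/
def Z (u : U) (ε : Fin n → ℝ) : Fin n → ℝ :=
  S.parent_wf.fix fun i rec => S.f i (fun j => rec j.1 j.2) (ε i) (S.θ u i)

theorem Z_eq (u : U) (ε : Fin n → ℝ) (i : Fin n) :
    S.Z u ε i = S.f i (fun j => S.Z u ε j.1) (ε i) (S.θ u i) :=
  S.parent_wf.fix_eq _ i

theorem measurable_Z (u : U) : Measurable (S.Z u) := by
  refine measurable_pi_lambda _ fun i => ?_
  induction i using S.parent_wf.induction with
  | _ i ih =>
    have h : (fun ε => S.Z u ε i) =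
        fun ε => S.f i (fun j => S.Z u ε j.1) (ε i) (S.θ u i) := funext fun ε => S.Z_eq u ε i
    rw [h]
    exact (S.f_measurable i (S.θ u i)).comp
      ((measurable_pi_lambda _ fun j => ih j.1 j.2).prodMk (measurable_pi_apply i))

/-- The distribution of `Z` in domain `u`. -/
def law (u : U) : Measure (Fin n → ℝ) := (Measure.pi S.noise).map (S.Z u)

instance (u : U) : IsProbabilityMeasure (S.law u) := by
  have := S.noise_prob
  exact Measure.isProbabilityMeasure_map (S.measurable_Z u).aemeasurable

/-- `Z i` and `Z j` are conditionally independent given `(Z k)_{k ∈ C}`, in domain `u`. -/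
def CondIndepGiven (u : U) (i j : Fin n) (C : Set (Fin n)) : Prop :=
  CondIndepFun
    (MeasurableSpace.comap (fun (z : Fin n → ℝ) (k : C) => z k) MeasurableSpace.pi)
    (Measurable.comap_le (measurable_pi_lambda _ fun k => measurable_pi_apply k.1))
    (fun z : Fin n → ℝ => z i) (fun z : Fin n → ℝ => z j) (S.law u)

theorem condIndepGiven_rest_symm {u : U} {i j : Fin n}
    (h : S.CondIndepGiven u i j {i, j}ᶜ) : S.CondIndepGiven u j i {j, i}ᶜ := by
  rw [Set.pair_comm j i]
  exact CondIndepFun.symm h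

/-- The Markov network over `Z`: two distinct variables are non-adjacent exactly when they are
conditionally independent given all the others, in every domain. -/
def markovNetwork : SimpleGraph (Fin n) where
  Adj i j := i ≠ j ∧ ¬ ∀ u, S.CondIndepGiven u i j {i, j}ᶜ
  symm := ⟨fun _ _ h => ⟨h.1.symm, fun h' => h.2 fun u => S.condIndepGiven_rest_symm (h' u)⟩⟩
  loopless := ⟨fun _ h => h.1 rfl⟩

/-- The number of edges of the Markov network. -/
def numEdges : ℕ := S.markovNetwork.edgeSet.ncard

end LatentSEM

/-- A model of the data generating process `X = g(Z)`: a latent structural equation model whose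
variables have a density `p u` on `ℝⁿ` in each domain `u`, and a mixing function `g : ℝⁿ → ℝᵈ`
that is a `C²`-diffeomorphism onto its image. -/
structure Model (n d : ℕ) (U : Type v) extends LatentSEM n U where
  p : U → (Fin n → ℝ) → ℝ
  p_measurable : ∀ u, Measurable (p u)
  p_nonneg : ∀ u z, 0 ≤ p u z
  law_eq : ∀ u, toLatentSEM.law u = volume.withDensity fun z => ENNReal.ofReal (p u z)
  g : (Fin n → ℝ) → (Fin d → ℝ)
  g_diffeo : IsC2DiffeoOntoImage g

/-- The volume `√det(JᵀJ)` of the Jacobian matrix `J` of `g` at `z`. -/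
def jacobianVolume {n d : ℕ} (g : (Fin n → ℝ) → (Fin d → ℝ)) (z : Fin n → ℝ) : ℝ :=
  Real.sqrt ((LinearMap.toMatrix' (fderiv ℝ g z).toLinearMap).transpose *
    LinearMap.toMatrix' (fderiv ℝ g z).toLinearMap).det

/-- The partial derivative in the `i`-th coordinate. -/
def partialDeriv {n : ℕ} (i : Fin n) (F : (Fin n → ℝ) → ℝ) (z : Fin n → ℝ) : ℝ :=
  fderiv ℝ F z (Pi.single i 1)

namespace Model

variable {n d : ℕ} {U : Type v} (M : Model n d U)

open Classical in
/-- The density of `X = g(Z)` in domain `u` with respect to the `n`-dimensional volume on the image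
of `g`, by the change of variables formula; it vanishes outside of that image. -/
def obsDensity (u : U) (x : Fin d → ℝ) : ℝ :=
  if h : ∃ z, M.g z = x then M.p u h.choose / jacobianVolume M.g h.choose else 0

/-- The model `M'` matches the distribution of `X` under `M` in all domains. -/
def Matches (M' : Model n d U) : Prop :=
  ∀ u, ∀ x ∈ Set.range M.g, M.obsDensity u x = M'.obsDensity u x

/-- Smooth and positive density. -/
def A1 : Prop := ∀ u, ContDiff ℝ 2 (M.p u) ∧ ∀ z, 0 < M.p u z

/-- The log-density of `Z` in domain `u`. -/
def logp (u : U) (z : Fin n → ℝ) : ℝ := Real.log (M.p u z)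

/-- The vector `w(z, u)` of the first derivatives, the pure second derivatives, and the mixed second
derivatives along the edges of the Markov network, of the log-density. -/
def w (u : U) (z : Fin n → ℝ) :
    Fin n ⊕ Fin n ⊕ {e : Fin n × Fin n // e.1 < e.2 ∧ M.markovNetwork.Adj e.1 e.2} → ℝ
  | .inl i => partialDeriv i (M.logp u) z
  | .inr (.inl i) => partialDeriv i (partialDeriv i (M.logp u)) z
  | .inr (.inr e) => partialDeriv e.1.1 (partialDeriv e.1.2 (M.logp u)) z

/-- Sufficient changes. -/
def A2 : Prop :=
  ∀ z, ∃ s : Fin (2 * n + M.numEdges + 1) → U,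
    LinearIndependent ℝ fun k : Fin (2 * n + M.numEdges) => M.w (s k.succ) z - M.w (s 0) z

/-- `M'` is a solution of the matching problem for `M` whose Markov network has the minimal number
of edges among all solutions. -/
def IsMinimalEstimate (M' : Model n d U) : Prop :=
  M.Matches M' ∧ ∀ M'' : Model n d U, M.Matches M'' → M'.numEdges ≤ M''.numEdges

end Model

/-- The intimate neighbors of `i`: the vertices `j ≠ i` that are adjacent to `i` and to all other
neighbors of `i`. -/
def intimateNeighbors {V : Type*} (G : SimpleGraph V) (i : V) : Set V :=
  {j | j ≠ i ∧ G.Adj i j ∧ ∀ k, G.Adj i k → k ≠ j → G.Adj j k}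

end CausalRep

end

namespace CausalRep

/-! Let `T` be the transition map from the true to the estimated latents, and `φ` its inverse on its
open image. The density of the estimated latents is that of `Z` composed with `φ`, times a ratio of
Jacobian volumes. This ratio is the same in every domain, so it cancels from differences of
log-densities between domains. Conditional independence makes a log-density additively separable in
the two coordinates (`CondIndepFun.density_corners_eq`). Hence along a non-edge `k`, `l` of the
estimated network the mixed derivative of such a difference, pulled back by `φ`, vanishes. By the
chain rule this is a linear relation on `w(z,u) - w(z,u₀)`, and A2 kills its coefficients
(`Model.A2.jacobian_products_eq_zero`): with `J = Dφ`, `J i k * J i l = 0`, and `J i k * J j l + J j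
k * J i l = 0` on every true edge `i`, `j`.

The rest is combinatorics. Since `det J ≠ 0`, some permutation `σ` has all `J (σ k) k ≠ 0`. The
relations then embed the true network into the estimated one, and minimality turns this into an
isomorphism. Consequently `J i k ≠ 0` forces N[i] ⊆ N[σ k] for closed neighborhoods. Inclusion is a
preorder, so this support pattern passes to the inverse matrix `DT`
(`exists_perm_closedNeighbors_subset`), and N[i] ⊆ N[j] with `j ≠ i` makes `j` an intimate neighbor
of `i`. Finally `σ` depends on the point; connectedness of ℝⁿ yields one permutation for all points
(`exists_perm_of_preconnected`). -/

/-! ### Conditional independence and densities. -/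

/-- The subset of `T` where the inequality fails is `m`-measurable, so the hypothesis applies to it
and makes the integral of a positive function nonpositive there; it is therefore null. -/
theorem ae_mul_condExp_indicator_le {Ω : Type*} {m mΩ : MeasurableSpace Ω} (hm : m ≤ mΩ)
    {μ : Measure Ω} [IsFiniteMeasure μ] {E E' T : Set Ω} (hE : MeasurableSet E)
    (hE' : MeasurableSet E') (hT : MeasurableSet[m] T) {a b : ℝ}
    (h : ∀ S ⊆ T, MeasurableSet[m] S → a * μ.real (E' ∩ S) ≤ b * μ.real (E ∩ S)) :
    ∀ᵐ x ∂μ, x ∈ T → a * (μ⟦E' | m⟧) x ≤ b * (μ⟦E | m⟧) x := by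
  set f : Ω → ℝ := fun x => a * (μ⟦E' | m⟧) x - b * (μ⟦E | m⟧) x with hf
  have hfm : StronglyMeasurable[m] f :=
    (stronglyMeasurable_condExp.const_mul a).sub (stronglyMeasurable_condExp.const_mul b)
  have hfi : Integrable f μ := (integrable_condExp.const_mul a).sub (integrable_condExp.const_mul b)
  set S : Set Ω := T ∩ {x | 0 < f x} with hS
  have hSm : MeasurableSet[m] S :=
    hT.inter (measurableSet_lt measurable_const hfm.measurable)
  have key : ∀ A : Set Ω, MeasurableSet A → ∫ x in S, (μ⟦A | m⟧) x ∂μ = μ.real (A ∩ S) := by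
    intro A hA
    rw [setIntegral_condExp hm ((integrable_const _).indicator hA) hSm, integral_indicator hA,
      setIntegral_const, smul_eq_mul, mul_one, measureReal_restrict_apply hA]
  have hle : ∫ x in S, f x ∂μ ≤ 0 := by
    rw [hf, integral_sub (integrable_condExp.const_mul a).integrableOn
      (integrable_condExp.const_mul b).integrableOn, integral_const_mul, integral_const_mul,
      key _ hE, key _ hE']
    linarith [h S Set.inter_subset_left hSm]
  have hnull : μ S = 0 := by
    by_contra hne
    have := (setIntegral_pos_iff_support_of_nonneg_ae (μ := μ) (s := S) (f := f)
      ((ae_restrict_iff' (hm _ hSm)).2 (ae_of_all _ fun x hx => hx.2.le)) hfi.integrableOn).2 (by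
        rw [Set.inter_eq_right.2 (show S ⊆ Function.support f from fun x hx =>
          Function.mem_support.2 hx.2.ne')]
        exact pos_iff_ne_zero.2 hne)
    linarith
  filter_upwards [measure_eq_zero_iff_ae_notMem.1 hnull] with x hx hxT
  by_contra hlt
  exact hx ⟨hxT, by show 0 < f x; simp only [hf]; linarith⟩

theorem measureReal_inter_eq_zero_of_condExp_eq_zero {Ω : Type*} {m mΩ : MeasurableSpace Ω}
    (hm : m ≤ mΩ) {μ : Measure Ω} [IsFiniteMeasure μ] {E T : Set Ω} (hE : MeasurableSet E)
    (hT : MeasurableSet[m] T) (h : ∀ᵐ x ∂μ, x ∈ T → (μ⟦E | m⟧) x = 0) : μ.real (E ∩ T) = 0 := by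
  rw [← setIntegral_eq_zero_of_ae_eq_zero h,
    setIntegral_condExp hm ((integrable_const _).indicator hE) hT, integral_indicator hE,
    setIntegral_const, smul_eq_mul, mul_one, measureReal_restrict_apply hE]

theorem measureReal_withDensity_le {Ω : Type*} [MeasurableSpace Ω] {ν : Measure Ω} {p : Ω → ℝ}
    {b : ℝ} (hb : 0 ≤ b) {A : Set Ω} (hA : MeasurableSet A) (hfin : ν A ≠ ⊤)
    (h : ∀ x ∈ A, p x ≤ b) :
    (ν.withDensity fun z => ENNReal.ofReal (p z)).real A ≤ b * ν.real A := by
  have : (ν.withDensity fun z => ENNReal.ofReal (p z)) A ≤ ENNReal.ofReal b * ν A := by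
    rw [withDensity_apply _ hA, ← setLIntegral_const]
    exact setLIntegral_mono' hA fun x hx => ENNReal.ofReal_le_ofReal (h x hx)
  have h2 := ENNReal.toReal_mono (ENNReal.mul_ne_top ENNReal.ofReal_ne_top hfin) this
  rwa [ENNReal.toReal_mul, ENNReal.toReal_ofReal hb] at h2

theorem le_measureReal_withDensity {Ω : Type*} [MeasurableSpace Ω] {ν : Measure Ω} {p : Ω → ℝ}
    [IsFiniteMeasure (ν.withDensity fun z => ENNReal.ofReal (p z))]
    {a : ℝ} (ha : 0 ≤ a) {A : Set Ω} (hA : MeasurableSet A) (h : ∀ x ∈ A, a ≤ p x) :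
    a * ν.real A ≤ (ν.withDensity fun z => ENNReal.ofReal (p z)).real A := by
  have : ENNReal.ofReal a * ν A ≤ (ν.withDensity fun z => ENNReal.ofReal (p z)) A := by
    rw [withDensity_apply _ hA, ← setLIntegral_const]
    exact setLIntegral_mono' hA fun x hx => ENNReal.ofReal_le_ofReal (h x hx)
  have h2 := ENNReal.toReal_mono (measure_ne_top _ _) this
  rwa [ENNReal.toReal_mul, ENNReal.toReal_ofReal ha] at h2

/-- The cylinder over the square of half side `δ` around the coordinates `i`, `j` of `c`. -/
def squareCylinder {n : ℕ} (i j : Fin n) (δ : ℝ) (c : Fin n → ℝ) : Set (Fin n → ℝ) :=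
  (fun z => z i) ⁻¹' Metric.ball (c i) δ ∩ (fun z => z j) ⁻¹' Metric.ball (c j) δ

theorem measurableSet_squareCylinder {n : ℕ} (i j : Fin n) (δ : ℝ) (c : Fin n → ℝ) :
    MeasurableSet (squareCylinder i j δ c) :=
  (measurable_pi_apply i measurableSet_ball).inter (measurable_pi_apply j measurableSet_ball)

/-- The σ-algebra generated by the coordinates in `C`. -/
abbrev coordSigma {n : ℕ} (C : Set (Fin n)) : MeasurableSpace (Fin n → ℝ) :=
  MeasurableSpace.comap (fun (z : Fin n → ℝ) (k : C) => z k) MeasurableSpace.pi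

theorem coordSigma_le {n : ℕ} (C : Set (Fin n)) : coordSigma C ≤ MeasurableSpace.pi :=
  Measurable.comap_le (measurable_pi_lambda _ fun k => measurable_pi_apply k.1)

/-- Translation by `c - c'` moves only the coordinates `i` and `j`, which `T` does not see. -/
theorem volume_squareCylinder_inter {n : ℕ} {i j : Fin n} {δ : ℝ} {c c' : Fin n → ℝ}
  (hc : ∀ k, k ≠ i → k ≠ j → c k = c' k) {T : Set (Fin n → ℝ)}
  (hT : MeasurableSet[coordSigma {i, j}ᶜ] T) :
  volume.real (squareCylinder i j δ c ∩ T) = volume.real (squareCylinder i j δ c' ∩ T) := by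
  obtain ⟨S, -, rfl⟩ := hT
  rw [measureReal_def, measureReal_def, ← measure_preimage_add_right volume (c - c')]
  congr 2
  ext z
  have : (fun k : ({i, j}ᶜ : Set (Fin n)) => z k.1 + (c k.1 - c' k.1)) = fun k => z k.1 := by
    funext k
    have hk := k.2
    simp only [Set.mem_compl_iff, Set.mem_insert_iff, Set.mem_singleton_iff, not_or] at hk
    simp [hc k hk.1 hk.2]
  simp only [squareCylinder, Set.mem_inter_iff, Set.mem_preimage, Metric.mem_ball,
    Real.dist_eq, Pi.add_apply, Pi.sub_apply]
  rw [show z i + (c i - c' i) - c i = z i - c' i by ring,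
    show z j + (c j - c' j) - c j = z j - c' j by ring, this]

/-- If the inequality failed, small squares around the four corners would have conditional
probabilities roughly proportional to the four density values, contradicting the product rule for
conditional probabilities. Continuity is required only at the corners because the estimated density
is controlled only on an open set. -/
theorem CondIndepFun.density_corners_le {n : ℕ} {i j : Fin n} {p : (Fin n → ℝ) → ℝ}
    {μ : Measure (Fin n → ℝ)} [IsFiniteMeasure μ]
    (hμ : μ = volume.withDensity fun z => ENNReal.ofReal (p z)) (hp : ∀ z, 0 ≤ p z)
    (hind : CondIndepFun (coordSigma {i, j}ᶜ) (coordSigma_le _)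
      (fun z : Fin n → ℝ => z i) (fun z : Fin n → ℝ => z j) μ)
    {c₀₀ c₁₀ c₀₁ c₁₁ : Fin n → ℝ}
    (h₁₀ : ∀ k, k ≠ i → c₁₀ k = c₀₀ k) (h₀₁ : ∀ k, k ≠ j → c₀₁ k = c₀₀ k)
    (h₁₁ : ∀ k, k ≠ j → c₁₁ k = c₁₀ k) (h₁₁' : ∀ k, k ≠ i → c₁₁ k = c₀₁ k) (hij : i ≠ j)
    (k₀₀ : ContinuousAt p c₀₀) (k₁₀ : ContinuousAt p c₁₀) (k₀₁ : ContinuousAt p c₀₁)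
    (k₁₁ : ContinuousAt p c₁₁) : p c₀₀ * p c₁₁ ≤ p c₁₀ * p c₀₁ := by
  by_contra! hlt
  have hm := coordSigma_le ({i, j}ᶜ : Set (Fin n))
  obtain ⟨ε, hε, hεlt, hε₀, hε₁⟩ : ∃ ε : ℝ, 0 < ε ∧
      (p c₁₀ + ε) * (p c₀₁ + ε) < (p c₀₀ - ε) * (p c₁₁ - ε) ∧ 0 < p c₀₀ - ε ∧ 0 < p c₁₁ - ε := by
    have hpos : 0 < p c₀₀ * p c₁₁ := (mul_nonneg (hp _) (hp _)).trans_lt hlt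
    have h0 : 0 < p c₀₀ := (hp _).lt_of_ne fun h => by simp [← h] at hpos
    have h1 : 0 < p c₁₁ := (hp _).lt_of_ne fun h => by simp [← h] at hpos
    have e1 : ∀ᶠ ε : ℝ in nhds 0, (p c₁₀ + ε) * (p c₀₁ + ε) < (p c₀₀ - ε) * (p c₁₁ - ε) :=
      ContinuousAt.eventually_lt (by fun_prop) (by fun_prop) (by simpa using hlt)
    have e2 : ∀ᶠ ε : ℝ in nhds 0, 0 < p c₀₀ - ε :=
      ContinuousAt.eventually_lt (by fun_prop) (by fun_prop) (by simpa using h0)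
    have e3 : ∀ᶠ ε : ℝ in nhds 0, 0 < p c₁₁ - ε :=
      ContinuousAt.eventually_lt (by fun_prop) (by fun_prop) (by simpa using h1)
    have e4 := ((e1.and (e2.and e3)).filter_mono nhdsWithin_le_nhds).and
      (self_mem_nhdsWithin (s := Set.Ioi (0 : ℝ)))
    obtain ⟨ε, h, h'⟩ := e4.exists
    exact ⟨ε, h', h.1, h.2⟩
  have hnear : ∀ c, ContinuousAt p c → ∀ᶠ δ : ℝ in nhdsWithin 0 (Set.Ioi 0),
      ∀ z ∈ Metric.ball c δ, p c - ε < p z ∧ p z < p c + ε := by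
    intro c hc
    obtain ⟨δ, hδ, h⟩ := Metric.continuousAt_iff.1 hc ε hε
    filter_upwards [Ioo_mem_nhdsGT hδ] with r hr z hz
    have := abs_lt.1 (h (lt_trans hz hr.2))
    constructor <;> linarith
  obtain ⟨δ, ⟨n₀₀, n₁₀, n₀₁, n₁₁⟩, hδ⟩ := (((hnear _ k₀₀).and ((hnear _ k₁₀).and
    ((hnear _ k₀₁).and (hnear _ k₁₁)))).and self_mem_nhdsWithin).exists
  have hδ : 0 < δ := hδ
  set E := squareCylinder i j δ with hE
  have hEm : ∀ c, MeasurableSet (E c) := measurableSet_squareCylinder i j δ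
  -- `T` confines the remaining coordinates, which all corners share, so that each cylinder meets
  -- `T` in a sup-norm ball.
  set T : Set (Fin n → ℝ) := {z | ∀ k : ({i, j}ᶜ : Set (Fin n)), dist (z k) (c₀₀ k) < δ} with hTd
  have hT : MeasurableSet[coordSigma {i, j}ᶜ] T := by
    refine ⟨{y | ∀ k, dist (y k) (c₀₀ k) < δ}, ?_, rfl⟩
    have : MeasurableSet (⋂ k, (fun y : ({i, j}ᶜ : Set (Fin n)) → ℝ => y k) ⁻¹'
        Metric.ball (c₀₀ k) δ) :=
      MeasurableSet.iInter fun k => measurable_pi_apply k measurableSet_ball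
    convert this using 1
    ext y
    simp
  have hball : ∀ c, (∀ k, k ≠ i → k ≠ j → c k = c₀₀ k) → E c ∩ T = Metric.ball c δ := by
    intro c hc
    ext z
    rw [Metric.mem_ball, dist_pi_lt_iff hδ]
    constructor
    · rintro ⟨⟨h1, h2⟩, h3⟩ k
      by_cases hki : k = i
      · subst hki; exact h1
      by_cases hkj : k = j
      · subst hkj; exact h2
      rw [hc k hki hkj]
      exact h3 ⟨k, by simp [hki, hkj]⟩
    · intro h
      refine ⟨⟨h i, h j⟩, fun k => ?_⟩
      have hk := k.2
      simp only [Set.mem_compl_iff, Set.mem_insert_iff, Set.mem_singleton_iff, not_or] at hk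
      rw [← hc k hk.1 hk.2]
      exact h k
  have d₁₀ : ∀ k, k ≠ i → k ≠ j → c₁₀ k = c₀₀ k := fun k hi _ => h₁₀ k hi
  have d₀₁ : ∀ k, k ≠ i → k ≠ j → c₀₁ k = c₀₀ k := fun k _ hj => h₀₁ k hj
  have d₁₁ : ∀ k, k ≠ i → k ≠ j → c₁₁ k = c₀₀ k := fun k hi hj => (h₁₁ k hj).trans (h₁₀ k hi)
  have lower : ∀ c, (∀ k, k ≠ i → k ≠ j → c k = c₀₀ k) → 0 < p c - ε →
      (∀ z ∈ Metric.ball c δ, p c - ε < p z ∧ p z < p c + ε) →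
      ∀ S ⊆ T, MeasurableSet[coordSigma {i, j}ᶜ] S →
        (p c - ε) * volume.real (E c₀₀ ∩ S) ≤ μ.real (E c ∩ S) := by
    intro c hc hpos hnc S hST hS
    rw [← volume_squareCylinder_inter hc hS]
    subst hμ
    exact le_measureReal_withDensity hpos.le ((hEm c).inter (hm _ hS)) fun x hx =>
      (hnc x (hball c hc ▸ ⟨hx.1, hST hx.2⟩)).1.le
  have upper : ∀ c, (∀ k, k ≠ i → k ≠ j → c k = c₀₀ k) →
      (∀ z ∈ Metric.ball c δ, p c - ε < p z ∧ p z < p c + ε) →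
      ∀ S ⊆ T, MeasurableSet[coordSigma {i, j}ᶜ] S →
        μ.real (E c ∩ S) ≤ (p c + ε) * volume.real (E c₀₀ ∩ S) := by
    intro c hc hnc S hST hS
    rw [← volume_squareCylinder_inter hc hS]
    subst hμ
    have hsub : E c ∩ S ⊆ Metric.ball c δ := fun x hx => hball c hc ▸ ⟨hx.1, hST hx.2⟩
    exact measureReal_withDensity_le (add_nonneg (hp _) hε.le) ((hEm c).inter (hm _ hS))
      (measure_lt_top_of_subset hsub measure_ball_lt_top.ne).ne fun x hx => (hnc x (hsub hx)).2.le
  have compare : ∀ c c', (∀ k, k ≠ i → k ≠ j → c k = c₀₀ k) →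
      (∀ k, k ≠ i → k ≠ j → c' k = c₀₀ k) → 0 < p c - ε →
      (∀ z ∈ Metric.ball c δ, p c - ε < p z ∧ p z < p c + ε) →
      (∀ z ∈ Metric.ball c' δ, p c' - ε < p z ∧ p z < p c' + ε) →
      ∀ᵐ x ∂μ, x ∈ T → (p c - ε) * (μ⟦E c' | coordSigma {i, j}ᶜ⟧) x ≤ (p c' + ε) * (μ⟦E c | coordSigma {i, j}ᶜ⟧) x := by
    intro c c' hc hc' hpos hnc hnc'
    refine ae_mul_condExp_indicator_le hm (hEm c) (hEm c') hT fun S hST hS => ?_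
    have h1 := lower c hc hpos hnc S hST hS
    have h2 := upper c' hc' hnc' S hST hS
    have h3 : 0 ≤ p c' + ε := add_nonneg (hp _) hε.le
    nlinarith [mul_le_mul_of_nonneg_left h1 h3, mul_le_mul_of_nonneg_left h2 hpos.le]
  have hfac := (condIndepFun_iff_condExp_inter_preimage_eq_mul (hm' := hm) (measurable_pi_apply i)
    (measurable_pi_apply j)).1 hind
  have hfacE : ∀ c : Fin n → ℝ, ∀ᵐ x ∂μ, (μ⟦E c | coordSigma {i, j}ᶜ⟧) x =
      (μ⟦(fun z : Fin n → ℝ => z i) ⁻¹' Metric.ball (c i) δ | coordSigma {i, j}ᶜ⟧) x *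
      (μ⟦(fun z : Fin n → ℝ => z j) ⁻¹' Metric.ball (c j) δ | coordSigma {i, j}ᶜ⟧) x := fun c =>
    hfac _ _ measurableSet_ball measurableSet_ball
  have hnonneg : ∀ c : Fin n → ℝ, ∀ᵐ x ∂μ, 0 ≤ (μ⟦E c | coordSigma {i, j}ᶜ⟧) x := fun c =>
    condExp_nonneg (ae_of_all _ fun x => Set.indicator_nonneg (fun _ _ => zero_le_one) x)
  -- Multiplying the two comparisons and using the product rule bounds the same product of
  -- conditional probabilities with a strictly larger factor on the left, so that product is zero.
  have hzero : ∀ᵐ x ∂μ, x ∈ T → (μ⟦E c₀₀ | coordSigma {i, j}ᶜ⟧) x * (μ⟦E c₁₁ | coordSigma {i, j}ᶜ⟧) x = 0 := by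
    filter_upwards [compare c₀₀ c₁₀ (fun _ _ _ => rfl) d₁₀ hε₀ n₀₀ n₁₀,
      compare c₁₁ c₀₁ d₁₁ d₀₁ hε₁ n₁₁ n₀₁, hfacE c₀₀, hfacE c₁₀, hfacE c₀₁, hfacE c₁₁,
      hnonneg c₀₀, hnonneg c₁₀, hnonneg c₀₁, hnonneg c₁₁]
      with x g1 g2 e00 e10 e01 e11 p00 p10 p01 p11 hx
    have hprod : (μ⟦E c₁₀ | coordSigma {i, j}ᶜ⟧) x * (μ⟦E c₀₁ | coordSigma {i, j}ᶜ⟧) x = (μ⟦E c₀₀ | coordSigma {i, j}ᶜ⟧) x * (μ⟦E c₁₁ | coordSigma {i, j}ᶜ⟧) x := by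
      rw [e00, e10, e01, e11, h₁₁ i hij, h₁₁' j hij.symm, h₁₀ j hij.symm, h₀₁ i hij]
      ring
    have h3 := mul_le_mul (g1 hx) (g2 hx) (mul_nonneg hε₁.le p01)
      (mul_nonneg (add_nonneg (hp _) hε.le) p00)
    have h4 : (p c₀₀ - ε) * (p c₁₁ - ε) * ((μ⟦E c₀₀ | coordSigma {i, j}ᶜ⟧) x * (μ⟦E c₁₁ | coordSigma {i, j}ᶜ⟧) x) ≤
        (p c₁₀ + ε) * (p c₀₁ + ε) * ((μ⟦E c₀₀ | coordSigma {i, j}ᶜ⟧) x * (μ⟦E c₁₁ | coordSigma {i, j}ᶜ⟧) x) := by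
      calc _ = (p c₀₀ - ε) * (p c₁₁ - ε) * ((μ⟦E c₁₀ | coordSigma {i, j}ᶜ⟧) x * (μ⟦E c₀₁ | coordSigma {i, j}ᶜ⟧) x) := by rw [hprod]
        _ ≤ _ := by linarith
    have h5 := mul_nonneg p00 p11
    by_contra hne
    have h6 := lt_of_le_of_ne h5 (Ne.symm hne)
    exact absurd h4 (not_le.2 (mul_lt_mul_of_pos_right hεlt h6))
  have volzero : ∀ c, (∀ k, k ≠ i → k ≠ j → c k = c₀₀ k) → 0 < p c - ε →
      (∀ z ∈ Metric.ball c δ, p c - ε < p z ∧ p z < p c + ε) →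
      ∀ S ⊆ T, MeasurableSet[coordSigma {i, j}ᶜ] S → μ.real (E c ∩ S) = 0 → volume.real (E c₀₀ ∩ S) = 0 := by
    intro c hc hpos hnc S hST hS h0
    have := lower c hc hpos hnc S hST hS
    rw [h0] at this
    exact le_antisymm (by by_contra! h; nlinarith [mul_pos hpos h]) measureReal_nonneg
  have hmeas : ∀ c, MeasurableSet[coordSigma {i, j}ᶜ] {x | (μ⟦E c | coordSigma {i, j}ᶜ⟧) x = 0} := fun c =>
    measurableSet_eq_fun stronglyMeasurable_condExp.measurable measurable_const
  have v1 : volume.real (E c₀₀ ∩ (T ∩ {x | (μ⟦E c₀₀ | coordSigma {i, j}ᶜ⟧) x = 0})) = 0 :=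
    volzero c₀₀ (fun _ _ _ => rfl) hε₀ n₀₀ _ Set.inter_subset_left (hT.inter (hmeas _))
      (measureReal_inter_eq_zero_of_condExp_eq_zero hm (hEm _) (hT.inter (hmeas _))
        (ae_of_all _ fun x hx => hx.2))
  have v2 : volume.real (E c₀₀ ∩ (T ∩ {x | (μ⟦E c₁₁ | coordSigma {i, j}ᶜ⟧) x = 0})) = 0 :=
    volzero c₁₁ d₁₁ hε₁ n₁₁ _ Set.inter_subset_left (hT.inter (hmeas _))
      (measureReal_inter_eq_zero_of_condExp_eq_zero hm (hEm _) (hT.inter (hmeas _))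
        (ae_of_all _ fun x hx => hx.2))
  have v3 : volume.real (E c₀₀ ∩
      (T ∩ ({x | (μ⟦E c₀₀ | coordSigma {i, j}ᶜ⟧) x = 0}ᶜ ∩ {x | (μ⟦E c₁₁ | coordSigma {i, j}ᶜ⟧) x = 0}ᶜ))) = 0 := by
    refine volzero c₀₀ (fun _ _ _ => rfl) hε₀ n₀₀ _ Set.inter_subset_left
      (hT.inter ((hmeas _).compl.inter (hmeas _).compl)) ?_
    have hnull : μ (T ∩ ({x | (μ⟦E c₀₀ | coordSigma {i, j}ᶜ⟧) x = 0}ᶜ ∩ {x | (μ⟦E c₁₁ | coordSigma {i, j}ᶜ⟧) x = 0}ᶜ)) = 0 := by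
      refine measure_eq_zero_iff_ae_notMem.2 ?_
      filter_upwards [hzero] with x hx hx'
      exact (mul_eq_zero.1 (hx hx'.1)).elim hx'.2.1 hx'.2.2
    rw [measureReal_def, measure_mono_null Set.inter_subset_right hnull, ENNReal.toReal_zero]
  -- `T` is covered by the zero sets of the two conditional probabilities and a `μ`-null remainder;
  -- each meets the cylinder in volume zero, whereas a ball has positive volume.
  have hsum : volume.real (E c₀₀ ∩ T) = 0 := by
    refine le_antisymm ?_ measureReal_nonneg
    have hfin : ∀ S ⊆ T, volume (E c₀₀ ∩ S) ≠ ⊤ := fun S hS =>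
      (measure_lt_top_of_subset ((Set.inter_subset_inter_right _ hS).trans
        (hball c₀₀ fun _ _ _ => rfl).subset) measure_ball_lt_top.ne).ne
    set A := {x | (μ⟦E c₀₀ | coordSigma {i, j}ᶜ⟧) x = 0}
    set B := {x | (μ⟦E c₁₁ | coordSigma {i, j}ᶜ⟧) x = 0}
    calc volume.real (E c₀₀ ∩ T)
        ≤ volume.real (E c₀₀ ∩ (T ∩ A) ∪ (E c₀₀ ∩ (T ∩ B) ∪ E c₀₀ ∩ (T ∩ (Aᶜ ∩ Bᶜ)))) := by
          refine measureReal_mono (fun x hx => ?_) ?_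
          · by_cases hA : x ∈ A
            · exact Or.inl ⟨hx.1, hx.2, hA⟩
            by_cases hB : x ∈ B
            · exact Or.inr (Or.inl ⟨hx.1, hx.2, hB⟩)
            exact Or.inr (Or.inr ⟨hx.1, hx.2, hA, hB⟩)
          · exact measure_union_ne_top (hfin _ Set.inter_subset_left) (measure_union_ne_top
              (hfin _ Set.inter_subset_left) (hfin _ Set.inter_subset_left))
      _ ≤ volume.real (E c₀₀ ∩ (T ∩ A)) + (volume.real (E c₀₀ ∩ (T ∩ B)) +
          volume.real (E c₀₀ ∩ (T ∩ (Aᶜ ∩ Bᶜ)))) :=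
          (measureReal_union_le _ _).trans (add_le_add_right (measureReal_union_le _ _) _)
      _ = 0 := by rw [v1, v2, v3]; simp
  rw [hball c₀₀ fun _ _ _ => rfl, measureReal_def, ENNReal.toReal_eq_zero_iff] at hsum
  exact hsum.elim (Metric.measure_ball_pos volume c₀₀ hδ).ne' measure_ball_lt_top.ne

/-- The reverse inequality is the same lemma for the square reflected in coordinate `i`. -/
theorem CondIndepFun.density_corners_eq {n : ℕ} {i j : Fin n} {p : (Fin n → ℝ) → ℝ}
    {μ : Measure (Fin n → ℝ)} [IsFiniteMeasure μ]
    (hμ : μ = volume.withDensity fun z => ENNReal.ofReal (p z)) (hp : ∀ z, 0 ≤ p z)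
    (hind : CondIndepFun (coordSigma {i, j}ᶜ) (coordSigma_le _)
      (fun z : Fin n → ℝ => z i) (fun z : Fin n → ℝ => z j) μ)
    {c₀₀ c₁₀ c₀₁ c₁₁ : Fin n → ℝ}
    (h₁₀ : ∀ k, k ≠ i → c₁₀ k = c₀₀ k) (h₀₁ : ∀ k, k ≠ j → c₀₁ k = c₀₀ k)
    (h₁₁ : ∀ k, k ≠ j → c₁₁ k = c₁₀ k) (h₁₁' : ∀ k, k ≠ i → c₁₁ k = c₀₁ k) (hij : i ≠ j)
    (k₀₀ : ContinuousAt p c₀₀) (k₁₀ : ContinuousAt p c₁₀) (k₀₁ : ContinuousAt p c₀₁)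
    (k₁₁ : ContinuousAt p c₁₁) : p c₀₀ * p c₁₁ = p c₁₀ * p c₀₁ :=
  le_antisymm
    (CondIndepFun.density_corners_le hμ hp hind h₁₀ h₀₁ h₁₁ h₁₁' hij k₀₀ k₁₀ k₀₁ k₁₁)
    (CondIndepFun.density_corners_le hμ hp hind (fun k hk => (h₁₀ k hk).symm) h₁₁
      h₀₁ (fun k hk => (h₁₁' k hk).symm) hij k₁₀ k₀₀ k₁₁ k₀₁)

open Filter Topology

/-! ### Calculus of partial derivatives. -/

section PartialDerivatives

variable {n : ℕ}

theorem fderiv_apply_eq_sum_partialDeriv (F : (Fin n → ℝ) → ℝ) (x v : Fin n → ℝ) :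
    fderiv ℝ F x v = ∑ i, v i * partialDeriv i F x := by
  conv_lhs => rw [pi_eq_sum_univ' v]
  simp [partialDeriv, map_sum]

theorem partialDeriv_comp {m : ℕ} {H : (Fin n → ℝ) → ℝ} {φ : (Fin m → ℝ) → (Fin n → ℝ)}
    {y : Fin m → ℝ} (hH : DifferentiableAt ℝ H (φ y)) (hφ : DifferentiableAt ℝ φ y) (l : Fin m) :
    partialDeriv l (fun x => H (φ x)) y =
      ∑ i, partialDeriv i H (φ y) * partialDeriv l (fun x => φ x i) y := by
  have h1 : fderiv ℝ (fun x => H (φ x)) y = (fderiv ℝ H (φ y)).comp (fderiv ℝ φ y) :=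
    fderiv_comp y hH hφ
  rw [partialDeriv, h1, ContinuousLinearMap.comp_apply, fderiv_apply_eq_sum_partialDeriv]
  refine Finset.sum_congr rfl fun i _ => ?_
  have h2 : HasFDerivAt (fun x => φ x i) ((ContinuousLinearMap.proj i).comp (fderiv ℝ φ y)) y :=
    (hasFDerivAt_pi'.1 hφ.hasFDerivAt) i
  rw [mul_comm, partialDeriv, partialDeriv, h2.fderiv]
  rfl

theorem contDiffAt_partialDeriv {F : (Fin n → ℝ) → ℝ} {x : Fin n → ℝ} (hF : ContDiffAt ℝ 2 F x)
    (i : Fin n) : ContDiffAt ℝ 1 (partialDeriv i F) x :=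
  (hF.fderiv_right (m := 1) (by norm_num)).clm_apply contDiffAt_const

theorem partialDeriv_comm {F : (Fin n → ℝ) → ℝ} {x : Fin n → ℝ} (hF : ContDiffAt ℝ 2 F x)
    (i j : Fin n) :
    partialDeriv i (partialDeriv j F) x = partialDeriv j (partialDeriv i F) x := by
  have hd : DifferentiableAt ℝ (fderiv ℝ F) x :=
    (hF.fderiv_right (m := 1) (by norm_num)).differentiableAt (by norm_num)
  have key : ∀ a b : Fin n, partialDeriv a (partialDeriv b F) x =
      fderiv ℝ (fderiv ℝ F) x (Pi.single a 1) (Pi.single b 1) := by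
    intro a b
    unfold partialDeriv
    rw [fderiv_clm_apply hd (differentiableAt_const _)]
    simp
  rw [key, key]
  exact (hF.isSymmSndFDerivAt (by simp)).eq _ _

theorem partialDeriv_sub {F G : (Fin n → ℝ) → ℝ} {x : Fin n → ℝ} (hF : DifferentiableAt ℝ F x)
    (hG : DifferentiableAt ℝ G x) (i : Fin n) :
    partialDeriv i (fun z => F z - G z) x = partialDeriv i F x - partialDeriv i G x := by
  rw [partialDeriv, fderiv_fun_sub hF hG]
  rfl

theorem partialDeriv_partialDeriv_comp {m : ℕ} {H : (Fin n → ℝ) → ℝ}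
    {φ : (Fin m → ℝ) → (Fin n → ℝ)} {y : Fin m → ℝ} (hH : ContDiff ℝ 2 H)
    (hφ : ContDiffAt ℝ 2 φ y) (k l : Fin m) :
    partialDeriv k (partialDeriv l fun x => H (φ x)) y =
      ∑ i, ((∑ j, partialDeriv j (partialDeriv i H) (φ y) * partialDeriv k (fun x => φ x j) y) *
          partialDeriv l (fun x => φ x i) y +
        partialDeriv i H (φ y) * partialDeriv k (partialDeriv l fun x => φ x i) y) := by
  -- Being `C²` at a point is an open condition, so the first-order formula holds near `y` and can
  -- be differentiated again.
  have hev : partialDeriv l (fun x => H (φ x)) =ᶠ[𝓝 y] fun x =>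
      ∑ i, partialDeriv i H (φ x) * partialDeriv l (fun x => φ x i) x := by
    filter_upwards [hφ.eventually (by simp)] with x hx
    exact partialDeriv_comp (hH.differentiable (by norm_num) _)
      (hx.differentiableAt (by norm_num)) l
  have hφd : DifferentiableAt ℝ φ y := hφ.differentiableAt (by norm_num)
  have h1 : ∀ i, Differentiable ℝ (partialDeriv i H) := fun i x =>
    (contDiffAt_partialDeriv hH.contDiffAt i).differentiableAt (by norm_num)
  have h2 : ∀ i, DifferentiableAt ℝ (partialDeriv l fun x => φ x i) y := fun i =>
    (contDiffAt_partialDeriv (contDiffAt_pi.1 hφ i) l).differentiableAt (by norm_num)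
  have h3 : ∀ i, DifferentiableAt ℝ (fun x => partialDeriv i H (φ x)) y := fun i =>
    (h1 i _).comp y hφd
  rw [partialDeriv, hev.fderiv_eq, fderiv_fun_sum fun i _ => (h3 i).fun_mul (h2 i),
    sum_apply]
  refine Finset.sum_congr rfl fun i _ => ?_
  rw [fderiv_fun_mul (h3 i) (h2 i), ← partialDeriv_comp (h1 i _) hφd]
  simp only [partialDeriv, add_apply, smul_apply,
    smul_eq_mul]
  ring

/-- Differentiating in the second increment shows that `∂ₗG` is constant along direction `k` near
`x`. Separability is phrased by increments so that it can be combined from functions not known to be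
`C²`. -/
theorem partialDeriv_partialDeriv_eq_zero_of_separable {G : (Fin n → ℝ) → ℝ} {x : Fin n → ℝ}
    (hG : ContDiffAt ℝ 2 G x) {k l : Fin n}
    (h : ∀ᶠ q : ℝ × ℝ in 𝓝 0, G (x + q.1 • Pi.single k 1 + q.2 • Pi.single l 1) + G x =
      G (x + q.1 • Pi.single k 1) + G (x + q.2 • Pi.single l 1)) :
    partialDeriv k (partialDeriv l G) x = 0 := by
  have line : ∀ (F : (Fin n → ℝ) → ℝ) (y : Fin n → ℝ) (a : Fin n), DifferentiableAt ℝ F y →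
      HasDerivAt (fun t : ℝ => F (y + t • Pi.single a 1)) (partialDeriv a F y) 0 := by
    intro F y a hF
    have h1 : HasDerivAt (fun t : ℝ => y + t • (Pi.single a 1 : Fin n → ℝ)) (Pi.single a 1) 0 := by
      simpa using ((hasDerivAt_id (0 : ℝ)).smul_const (Pi.single a 1 : Fin n → ℝ)).const_add y
    have h2 : HasFDerivAt F (fderiv ℝ F y) (y + (0 : ℝ) • (Pi.single a 1 : Fin n → ℝ)) := by
      simpa using hF.hasFDerivAt
    exact h2.comp_hasDerivAt 0 h1
  have hcont : Tendsto (fun s : ℝ => x + s • (Pi.single k 1 : Fin n → ℝ)) (𝓝 0) (𝓝 x) := by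
    have : Continuous fun s : ℝ => x + s • (Pi.single k 1 : Fin n → ℝ) := by fun_prop
    simpa using this.tendsto 0
  have hev : ∀ᶠ s : ℝ in 𝓝 0, partialDeriv l G (x + s • Pi.single k 1) = partialDeriv l G x := by
    have h' : ∀ᶠ q : ℝ × ℝ in 𝓝 ((0 : ℝ), (0 : ℝ)),
      G (x + q.1 • Pi.single k 1 + q.2 • Pi.single l 1) + G x =
      G (x + q.1 • Pi.single k 1) + G (x + q.2 • Pi.single l 1) := h
    filter_upwards [h'.curry_nhds, hcont.eventually (hG.eventually (by simp))] with s hs hGs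
    have d1 := line G (x + s • Pi.single k 1) l (hGs.differentiableAt (by norm_num))
    have d2 := (line G x l (hG.differentiableAt (by norm_num))).const_add
      (G (x + s • Pi.single k 1) - G x)
    refine d1.unique (d2.congr_of_eventuallyEq ?_)
    filter_upwards [hs] with t ht
    linarith
  have d := line (partialDeriv l G) x k
    ((contDiffAt_partialDeriv hG l).differentiableAt (by norm_num))
  exact d.unique ((hasDerivAt_const 0 _).congr_of_eventuallyEq hev)

/-- `F` has zero derivative along the segment from `x` to `y`, whose direction is supported off `s`.
-/
theorem dependsOn_of_partialDeriv_eq_zero {F : (Fin n → ℝ) → ℝ} (hF : Differentiable ℝ F)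
    {s : Set (Fin n)} (h : ∀ i ∉ s, ∀ z, partialDeriv i F z = 0) : DependsOn F s := by
  intro x y hxy
  have hd : ∀ t : ℝ, HasDerivAt (fun t : ℝ => F (x + t • (y - x))) 0 t := by
    intro t
    have h1 : HasDerivAt (fun t : ℝ => x + t • (y - x)) (y - x) t := by
      simpa using ((hasDerivAt_id t).smul_const (y - x)).const_add x
    have h2 := (hF (x + t • (y - x))).hasFDerivAt.comp_hasDerivAt t h1
    have h3 : fderiv ℝ F (x + t • (y - x)) (y - x) = 0 := by
      rw [fderiv_apply_eq_sum_partialDeriv]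
      refine Finset.sum_eq_zero fun i _ => ?_
      by_cases hi : i ∈ s
      · simp [hxy i hi]
      · rw [h i hi, mul_zero]
    rwa [h3] at h2
  have := is_const_of_deriv_eq_zero (fun t => (hd t).differentiableAt) (fun t => (hd t).deriv) 0 1
  simpa using this

theorem exists_update_ne_of_partialDeriv_ne_zero {F : (Fin n → ℝ) → ℝ} {z : Fin n → ℝ} {i : Fin n}
    (hF : DifferentiableAt ℝ F z) (h : partialDeriv i F z ≠ 0) :
    ∃ t : ℝ, F (Function.update z i t) ≠ F z := by
  by_contra! hc
  have h1 := (hasDerivAt_update z i (z i))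
  have h2 : HasFDerivAt F (fderiv ℝ F z) (Function.update z i (z i)) := by
    simpa using hF.hasFDerivAt
  have h3 := h2.comp_hasDerivAt (z i) h1
  refine h (h3.unique ?_)
  have : F ∘ Function.update z i = fun _ => F z := funext hc
  rw [this]
  exact hasDerivAt_const _ _

end PartialDerivatives

/-! ### Diffeomorphisms onto their images. -/

section Diffeomorphisms

/-- This is the inverse function theorem: an injective derivative of an endomorphism in finite
dimension is invertible. `F` need not be onto, so smoothness of `φ` is claimed only on the open
image. -/
theorem exists_contDiffAt_leftInverse {E : Type*} [NormedAddCommGroup E] [NormedSpace ℝ E]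
    [FiniteDimensional ℝ E] {F : E → E} (hF : ContDiff ℝ 2 F) (hinj : Function.Injective F)
    (hd : ∀ x, Function.Injective (fderiv ℝ F x)) :
    IsOpen (Set.range F) ∧ ∃ φ : E → E, Function.LeftInverse φ F ∧
      ∀ y ∈ Set.range F, ContDiffAt ℝ 2 φ y := by
  have : CompleteSpace E := FiniteDimensional.complete ℝ E
  choose e he using fun x => show ∃ e : E ≃L[ℝ] E, (e : E →L[ℝ] E) = fderiv ℝ F x from
    ⟨(LinearEquiv.ofInjectiveEndo (fderiv ℝ F x).toLinearMap (hd x)).toContinuousLinearEquiv,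
      by ext; rfl⟩
  have hs : ∀ x, HasStrictFDerivAt F (e x : E →L[ℝ] E) x := fun x => by
    rw [he]; exact hF.contDiffAt.hasStrictFDerivAt (by norm_num)
  have hopen : IsOpenMap F := isOpenMap_of_hasStrictFDerivAt_equiv hs
  have hemb : Topology.IsOpenEmbedding F :=
    Topology.IsOpenEmbedding.of_continuous_injective_isOpenMap hF.continuous hinj hopen
  refine ⟨hopen.isOpen_range, ?_⟩
  rcases isEmpty_or_nonempty E with hE | hE
  · exact ⟨id, fun x => (hE.false x).elim, fun y => (hE.false y).elim⟩
  refine ⟨(hemb.toOpenPartialHomeomorph F).symm,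
    fun x => hemb.toOpenPartialHomeomorph_left_inv F, ?_⟩
  rintro _ ⟨x, rfl⟩
  refine OpenPartialHomeomorph.contDiffAt_symm (f₀' := e x) _ (by simp) ?_ ?_
  · rw [hemb.toOpenPartialHomeomorph_left_inv F]
    exact (hs x).hasFDerivAt
  · exact hF.contDiffAt

/-- Injectivity is Rolle's theorem. -/
theorem isC2DiffeoOntoImage_of_deriv_ne_zero {h : ℝ → ℝ} (hh : ContDiff ℝ 2 h)
    (hd : ∀ t, deriv h t ≠ 0) : IsC2DiffeoOntoImage h := by
  have hinj : Function.Injective h := by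
    intro a b hab
    by_contra hne
    wlog hlt : a < b generalizing a b
    · exact this hab.symm (Ne.symm hne) (lt_of_le_of_ne (not_lt.1 hlt) (Ne.symm hne))
    obtain ⟨c, -, hc⟩ := exists_deriv_eq_zero hlt hh.continuous.continuousOn hab
    exact hd c hc
  obtain ⟨-, φ, hφ, hφs⟩ := exists_contDiffAt_leftInverse hh hinj fun x => by
    rw [injective_iff_map_eq_zero]
    intro a ha
    have : fderiv ℝ h x a = a * deriv h x := by
      rw [← fderiv_apply_one_eq_deriv, ← smul_eq_mul, ← map_smul]; simp
    rw [this] at ha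
    exact (mul_eq_zero.1 ha).resolve_right (hd x)
  exact ⟨hh, φ, fun y hy => (hφs y hy).contDiffWithinAt, hφ⟩

variable {E F : Type*} [NormedAddCommGroup E] [NormedSpace ℝ E]
    [NormedAddCommGroup F] [NormedSpace ℝ F]

theorem IsC2DiffeoOntoImage.injective {g : E → F} (hg : IsC2DiffeoOntoImage g) :
    Function.Injective g :=
  hg.2.choose_spec.2.injective

theorem IsC2DiffeoOntoImage.fderiv_injective {g : E → F} (hg : IsC2DiffeoOntoImage g) (z : E) :
    Function.Injective (fderiv ℝ g z) := by
  obtain ⟨hg2, ginv, hinv, hleft⟩ := hg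
  have h1 := ((hinv (g z) ⟨z, rfl⟩).differentiableWithinAt (by norm_num)).hasFDerivWithinAt
  have h2 := (hg2.differentiable (by norm_num) z).hasFDerivAt
  have h3 := h1.comp_hasFDerivAt z h2 (Eventually.of_forall fun x => ⟨x, rfl⟩)
  have h4 : ginv ∘ g = id := funext hleft
  rw [h4] at h3
  have h5 := h3.unique (hasFDerivAt_id z)
  refine Function.LeftInverse.injective (g := fderivWithin ℝ ginv (Set.range g) (g z)) fun v => ?_
  simpa using congrArg (fun L : E →L[ℝ] E => L v) h5

/-- The transition map between two diffeomorphisms onto their images. -/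
theorem IsC2DiffeoOntoImage.exists_transition {E' : Type*} [NormedAddCommGroup E']
    [NormedSpace ℝ E'] {g : E → F} {g' : E' → F} (hg : IsC2DiffeoOntoImage g)
    (hg' : IsC2DiffeoOntoImage g') (hsub : Set.range g ⊆ Set.range g') :
    ∃ T : E → E', (∀ z, g' (T z) = g z) ∧ ContDiff ℝ 2 T ∧ Function.Injective T ∧
      ∀ z, Function.Injective (fderiv ℝ T z) := by
  obtain ⟨hg'2, ginv, hinv, hleft⟩ := id hg'
  have hT : ∀ z, g' (ginv (g z)) = g z := by
    intro z
    obtain ⟨y, hy⟩ := hsub ⟨z, rfl⟩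
    rw [← hy, hleft]
  have hT2 : ContDiff ℝ 2 fun z => ginv (g z) := by
    rw [← contDiffOn_univ]
    exact hinv.comp hg.1.contDiffOn fun z _ => hsub ⟨z, rfl⟩
  refine ⟨fun z => ginv (g z), hT, hT2, fun a b hab => hg.injective ?_, fun z => ?_⟩
  · rw [← hT a, ← hT b]
    exact congrArg g' hab
  · have h1 : fderiv ℝ g z = (fderiv ℝ g' (ginv (g z))).comp
        (fderiv ℝ (fun z => ginv (g z)) z) := by
      rw [← fderiv_comp z (hg'2.differentiable (by norm_num) _)
        (hT2.differentiable (by norm_num) z)]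
      exact congrArg (fun f => fderiv ℝ f z) (funext fun z => (hT z).symm)
    have h2 := hg.fderiv_injective z
    rw [h1] at h2
    exact Function.Injective.of_comp h2

/-- The Gram matrix of an injective linear map is positive definite. -/
theorem jacobianVolume_pos {n d : ℕ} {g : (Fin n → ℝ) → (Fin d → ℝ)} (hg : IsC2DiffeoOntoImage g)
    (z : Fin n → ℝ) : 0 < jacobianVolume g z := by
  refine Real.sqrt_pos.2 ?_
  set A := LinearMap.toMatrix' (fderiv ℝ g z).toLinearMap
  have hA : Function.Injective A.mulVec := by
    have : A.mulVec = fderiv ℝ g z := by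
      funext v
      rw [← Matrix.toLin'_apply, Matrix.toLin'_toMatrix']
      rfl
    rw [this]
    exact hg.fderiv_injective z
  have := (Matrix.PosDef.conjTranspose_mul_self A hA).det_pos
  rwa [Matrix.conjTranspose_eq_transpose_of_trivial] at this

theorem continuous_jacobianVolume {n d : ℕ} {g : (Fin n → ℝ) → (Fin d → ℝ)}
    (hg : IsC2DiffeoOntoImage g) : Continuous (jacobianVolume g) := by
  have h1 : Continuous (fderiv ℝ g) := hg.1.continuous_fderiv (by norm_num)
  have h2 : Continuous fun z => LinearMap.toMatrix' (fderiv ℝ g z).toLinearMap := by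
    refine continuous_matrix fun i j => ?_
    simp only [LinearMap.toMatrix'_apply]
    exact (continuous_apply i).comp (h1.clm_apply continuous_const)
  exact Real.continuous_sqrt.comp ((h2.matrix_transpose.matrix_mul h2).matrix_det)

end Diffeomorphisms

/-! ### Closed neighborhoods, permutations and matrix supports. -/

section MarkovCombinatorics

variable {V : Type*}

/-- The vertex `i` together with its neighbors. -/
def closedNeighbors (G : SimpleGraph V) (i : V) : Set V := {j | j = i ∨ G.Adj i j}

theorem mem_insert_intimateNeighbors_of_closedNeighbors_subset {G : SimpleGraph V} {a b : V}
    (h : closedNeighbors G a ⊆ closedNeighbors G b) : b ∈ {a} ∪ intimateNeighbors G a := by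
  by_cases hab : b = a
  · exact Or.inl hab
  · refine Or.inr ⟨hab, ?_, fun k hk hkb => (h (Or.inr hk)).resolve_left hkb⟩
    exact ((h (Or.inl rfl)).resolve_left (Ne.symm hab)).symm

variable [Fintype V]

/-- The cardinalities have equal sums on both sides, so no inclusion can be strict. -/
theorem eq_of_forall_subset_of_perm {f : V → Set V} (τ : Equiv.Perm V)
    (h : ∀ i, f (τ i) ⊆ f i) (i : V) : f (τ i) = f i := by
  have hle : ∀ i ∈ Finset.univ, (f (τ i)).ncard ≤ (f i).ncard := fun i _ =>
    Set.ncard_le_ncard (h i) (Set.toFinite _)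
  have hsum := (Finset.sum_eq_sum_iff_of_le hle).1 (Equiv.sum_comp τ fun i => (f i).ncard)
  exact Set.eq_of_subset_of_ncard_le (h i) (hsum i (Finset.mem_univ i)).ge (Set.toFinite _)

theorem comap_perm_eq_of_le {G H : SimpleGraph V} (σ : Equiv.Perm V)
    (hle : G.comap σ ≤ H) (hcard : H.edgeSet.ncard ≤ G.edgeSet.ncard) : G.comap σ = H := by
  have h1 : (G.comap σ).edgeSet.ncard = G.edgeSet.ncard :=
    Nat.card_congr (SimpleGraph.Iso.comap σ G).mapEdgeSet
  refine SimpleGraph.edgeSet_injective (Set.eq_of_subset_of_ncard_le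
    (SimpleGraph.edgeSet_mono hle) (by omega) (Set.toFinite _))

variable [DecidableEq V]

theorem exists_perm_prod_ne_zero {A : Matrix V V ℝ} (hA : A.det ≠ 0) :
    ∃ σ : Equiv.Perm V, ∏ i, A (σ i) i ≠ 0 := by
  rw [Matrix.det_apply] at hA
  obtain ⟨σ, -, hσ⟩ := Finset.exists_ne_zero_of_sum_ne_zero hA
  exact ⟨σ, fun h => hσ (by rw [h, smul_zero])⟩

/-- The inverse of a matrix whose support lies in a preorder (given here by inclusion of sets) has
its support in the same preorder. -/
theorem inv_apply_eq_zero_of_support_subset {W : Type*} {B : Matrix V V ℝ} (hB : B.det ≠ 0)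
    {f : V → Set W} (h : ∀ i j, B i j ≠ 0 → f i ⊆ f j) {i j : V} (hij : ¬ f i ⊆ f j) :
    B⁻¹ i j = 0 := by
  classical
  have : Invertible B := B.invertibleOfIsUnitDet (isUnit_iff_ne_zero.2 hB)
  -- With `i` fixed, the indices `a` with `f i ⊆ f a` form an upper set, so two blocks suffice.
  have hT : B.BlockTriangular fun a => decide (f i ⊆ f a) := by
    intro a b hab
    by_contra hne
    have h1 := Bool.lt_iff.1 hab
    simp only [decide_eq_false_iff_not, decide_eq_true_eq] at h1
    exact h1.1 (h1.2.trans (h a b hne))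
  exact Matrix.blockTriangular_inv_of_blockTriangular hT (by simp [Bool.lt_iff, hij])

theorem exists_perm_closedNeighbors_subset {G H : SimpleGraph V}
    (hcard : H.edgeSet.ncard ≤ G.edgeSet.ncard) {A J : Matrix V V ℝ} (hAJ : A * J = 1)
    (hJ : ∀ k l, k ≠ l → ¬ H.Adj k l → (∀ i, J i k * J i l = 0) ∧
      ∀ i j, G.Adj i j → J i k * J j l + J j k * J i l = 0) :
    ∃ σ : Equiv.Perm V, ∀ k i, A k i ≠ 0 →
      closedNeighbors G (σ k) ⊆ closedNeighbors G i := by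
  -- On a non-edge the first relation gives `J i l = 0`, so only one term of the second survives.
  have hsupp : ∀ i j k l, i = j ∨ G.Adj i j → k ≠ l → J i k ≠ 0 → J j l ≠ 0 → H.Adj k l := by
    intro i j k l hij hkl hik hjl
    by_contra hH
    obtain ⟨h1, h2⟩ := hJ k l hkl hH
    rcases hij with rfl | hij
    · exact (mul_ne_zero hik hjl) (h1 i)
    · have h3 : J i l = 0 := (mul_eq_zero.1 (h1 i)).resolve_left hik
      have h4 := h2 i j hij
      rw [h3, mul_zero, add_zero] at h4
      exact mul_ne_zero hik hjl h4
  have hdet : J.det ≠ 0 := by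
    intro h
    have := congrArg Matrix.det hAJ
    rw [Matrix.det_mul, h, mul_zero, Matrix.det_one] at this
    exact zero_ne_one this
  obtain ⟨σ, hσ⟩ := exists_perm_prod_ne_zero hdet
  have hσ' : ∀ k, J (σ k) k ≠ 0 := fun k => Finset.prod_ne_zero_iff.1 hσ k (Finset.mem_univ k)
  have hiso : G.comap σ = H := comap_perm_eq_of_le σ
    (fun k l hkl => hsupp (σ k) (σ l) k l (Or.inr hkl)
      hkl.ne (hσ' k) (hσ' l)) hcard
  have hsub : ∀ i k, J i k ≠ 0 → closedNeighbors G i ⊆ closedNeighbors G (σ k) := by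
    intro i k hik j hj
    obtain ⟨l, rfl⟩ := σ.surjective j
    by_cases hkl : k = l
    · exact Or.inl (congrArg σ hkl.symm)
    · have := hsupp i (σ l) k l (hj.imp Eq.symm id) hkl hik (hσ' l)
      rw [← hiso] at this
      exact Or.inr this
  refine ⟨σ, fun k i hki => ?_⟩
  by_contra hns
  -- Relabelling the columns of `J` by `σ` indexes rows and columns by the same vertices, as the
  -- preorder argument needs.
  have hinv : (J.submatrix id σ.symm)⁻¹ = A.submatrix σ.symm id := by
    refine Matrix.inv_eq_left_inv ?_
    refine (Matrix.submatrix_mul_equiv A J σ.symm (Equiv.refl V) σ.symm).trans ?_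
    rw [hAJ, Matrix.submatrix_one_equiv]
  have hdetB : (J.submatrix id σ.symm).det ≠ 0 := by
    rw [Matrix.det_permute']
    refine mul_ne_zero ?_ hdet
    exact_mod_cast (Units.ne_zero _)
  have h0 := inv_apply_eq_zero_of_support_subset hdetB (f := closedNeighbors G)
    (fun a b hab => by simpa using hsub a (σ.symm b) hab) hns
  rw [hinv] at h0
  simp at h0
  exact hki h0

/-- `σ` itself may jump between points, but the sets N[σ k] cannot: a nonzero product along `ρ`
determines them by `key` and stays nonzero nearby. -/
theorem exists_perm_of_preconnected {X : Type*} [TopologicalSpace X] [PreconnectedSpace X]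
    [Nonempty X] {G : SimpleGraph V} {A : X → Matrix V V ℝ} (hA : Continuous A)
    (hdet : ∀ z, (A z).det ≠ 0)
    (h : ∀ z, ∃ σ : Equiv.Perm V, ∀ k i, A z k i ≠ 0 →
      closedNeighbors G (σ k) ⊆ closedNeighbors G i) :
    ∃ ρ : Equiv.Perm V, (∀ i, ∃ z, A z (ρ i) i ≠ 0) ∧
      ∀ z i j, A z (ρ i) j ≠ 0 → closedNeighbors G i ⊆ closedNeighbors G j := by
  choose σ hσ using h
  have key : ∀ z (ρ : Equiv.Perm V), ∏ i, A z (ρ i) i ≠ 0 →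
      ∀ i, closedNeighbors G (σ z (ρ i)) = closedNeighbors G i := by
    intro z ρ hρ
    exact eq_of_forall_subset_of_perm (ρ.trans (σ z)) fun i =>
      hσ z _ _ (Finset.prod_ne_zero_iff.1 hρ i (Finset.mem_univ i))
  have hloc : IsLocallyConstant fun z k => closedNeighbors G (σ z k) := by
    rw [IsLocallyConstant.iff_eventually_eq]
    intro z₀
    obtain ⟨ρ, hρ⟩ := exists_perm_prod_ne_zero (hdet z₀)
    have hc : Continuous fun z => ∏ i, A z (ρ i) i :=
      continuous_finsetProd _ fun i _ => hA.matrix_elem _ _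
    filter_upwards [hc.continuousAt.eventually_ne hρ] with z hz
    funext k
    have h1 := key z ρ hz (ρ.symm k)
    have h2 := key z₀ ρ hρ (ρ.symm k)
    rw [Equiv.apply_symm_apply] at h1 h2
    rw [h1, h2]
  obtain ⟨z₀⟩ := ‹Nonempty X›
  obtain ⟨ρ, hρ⟩ := exists_perm_prod_ne_zero (hdet z₀)
  refine ⟨ρ, fun i => ⟨z₀, Finset.prod_ne_zero_iff.1 hρ i (Finset.mem_univ i)⟩,
    fun z i j hij => ?_⟩
  have h1 := congrFun (hloc.apply_eq_of_preconnectedSpace z z₀) (ρ i)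
  rw [← key z₀ ρ hρ i, ← h1]
  exact hσ z _ _ hij

end MarkovCombinatorics

/-! ### Counting edges and symmetric sums. -/

theorem card_ordered_adj_eq_ncard_edgeSet {V : Type*} [Finite V] [LinearOrder V]
    (G : SimpleGraph V) :
    Nat.card {e : V × V // e.1 < e.2 ∧ G.Adj e.1 e.2} = G.edgeSet.ncard := by
  refine Nat.card_congr (Equiv.ofBijective
    (fun e => (⟨s(e.1.1, e.1.2), e.2.2⟩ : G.edgeSet)) ⟨?_, ?_⟩)
  · rintro ⟨⟨a, b⟩, hab, h⟩ ⟨⟨c, d⟩, hcd, h'⟩ heq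
    have heq := Sym2.eq_iff.1 (congrArg Subtype.val heq)
    rcases heq with ⟨rfl, rfl⟩ | ⟨rfl, rfl⟩
    · rfl
    · exact absurd hab (not_lt.2 (le_of_lt hcd))
  · rintro ⟨e, he⟩
    induction e using Sym2.ind with
    | _ a b =>
      have hab : G.Adj a b := he
      rcases lt_or_gt_of_ne hab.ne with h | h
      · exact ⟨⟨(a, b), h, hab⟩, rfl⟩
      · exact ⟨⟨(b, a), h, hab.symm⟩, Subtype.ext Sym2.eq_swap⟩

/-- The vectors span by dimension count, so `c` is orthogonal to itself. -/
theorem eq_zero_of_dotProduct_eq_zero {ι κ : Type*} [Fintype ι] [Fintype κ] {v : κ → ι → ℝ}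
    (hv : LinearIndependent ℝ v) (hcard : Fintype.card κ = Fintype.card ι) {c : ι → ℝ}
    (h : ∀ k, c ⬝ᵥ v k = 0) : c = 0 := by
  have hspan := hv.span_eq_top_of_card_eq_finrank' (by simp [hcard])
  have hker : Submodule.span ℝ (Set.range v) ≤ LinearMap.ker (dotProductBilin ℝ ℝ c) := by
    rw [Submodule.span_le]
    rintro _ ⟨k, rfl⟩
    exact h k
  rw [hspan] at hker
  exact dotProduct_self_eq_zero.1 (hker (Submodule.mem_top (x := c)))

theorem sum_sum_eq_sum_ordered {V : Type*} [Fintype V] [LinearOrder V] (F : V → V → ℝ) :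
    ∑ i, ∑ j, F i j = ∑ i, F i i + ∑ e : V × V with e.1 < e.2, (F e.1 e.2 + F e.2 e.1) := by
  have hsplit : ∀ i j, F i j = (if i = j then F i j else 0) + ((if i < j then F i j else 0) +
      if j < i then F i j else 0) := by
    intro i j
    rcases lt_trichotomy i j with h | h | h
    · simp [h, h.ne, h.not_gt]
    · simp [h]
    · simp [h, h.ne', h.not_gt]
  calc ∑ i, ∑ j, F i j
      = ∑ i, ∑ j, ((if i = j then F i j else 0) + ((if i < j then F i j else 0) +
          if j < i then F i j else 0)) :=
        Finset.sum_congr rfl fun i _ => Finset.sum_congr rfl fun j _ => hsplit i j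
    _ = ∑ i, F i i + (∑ i, ∑ j, (if i < j then F i j else 0) +
          ∑ j, ∑ i, (if j < i then F i j else 0)) := by
        rw [Finset.sum_comm (f := fun j i => if j < i then F i j else 0)]
        simp [Finset.sum_add_distrib]
    _ = _ := by
        rw [← Fintype.sum_prod_type', ← Fintype.sum_prod_type', ← Finset.sum_add_distrib,
          Finset.sum_filter]
        congr 1
        refine Finset.sum_congr rfl fun e _ => ?_
        split_ifs <;> simp

universe v

/-- This puts the Hessian term of the chain rule in the coordinates of `w`: each edge once, with
symmetrised coefficient. -/
theorem sum_quadratic_eq_sum_edges {V : Type*} [Fintype V] [LinearOrder V] {G : SimpleGraph V}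
    [Fintype {e : V × V // e.1 < e.2 ∧ G.Adj e.1 e.2}] {S : V → V → ℝ}
    (hS : ∀ i j, S i j = S j i) (hzero : ∀ i j, i ≠ j → ¬ G.Adj i j → S i j = 0) (a b : V → ℝ) :
    ∑ i, (∑ j, S j i * a j) * b i = ∑ i, a i * b i * S i i +
      ∑ e : {e : V × V // e.1 < e.2 ∧ G.Adj e.1 e.2},
        (a e.1.1 * b e.1.2 + a e.1.2 * b e.1.1) * S e.1.1 e.1.2 := by
  classical
  simp only [Finset.sum_mul]
  rw [sum_sum_eq_sum_ordered]
  congr 1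
  · exact Finset.sum_congr rfl fun i _ => by ring
  · symm
    rw [← Finset.sum_subtype (Finset.univ.filter fun e : V × V => e.1 < e.2 ∧ G.Adj e.1 e.2)
      (by simp) fun e => (a e.1 * b e.2 + a e.2 * b e.1) * S e.1 e.2, ← Finset.filter_filter,
      Finset.sum_filter_of_ne]
    · exact Finset.sum_congr rfl fun e _ => by rw [hS e.2 e.1]; ring
    · intro e he hne
      by_contra hadj
      refine hne ?_
      rw [hzero e.1 e.2 (Finset.mem_filter.1 he).2.ne hadj, mul_zero]

/-! ### Matching models and the Jacobian relations. -/

namespace Model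

variable {n d : ℕ} {U : Type v}

theorem obsDensity_apply (M : Model n d U) (u : U) (z : Fin n → ℝ) :
    M.obsDensity u (M.g z) = M.p u z / jacobianVolume M.g z := by
  have h : ∃ y, M.g y = M.g z := ⟨z, rfl⟩
  rw [obsDensity, dif_pos h, M.g_diffeo.injective h.choose_spec]

/-- The true density of `X` is positive on the image of `M.g`, while the estimated one vanishes off
that of `M'.g`. -/
theorem Matches.range_subset {M M' : Model n d U} (h : M.Matches M') (hA1 : M.A1) [Nonempty U] :
    Set.range M.g ⊆ Set.range M'.g := by
  rintro _ ⟨z, rfl⟩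
  obtain ⟨u⟩ := ‹Nonempty U›
  have h1 := h u (M.g z) ⟨z, rfl⟩
  by_contra hne
  rw [obsDensity_apply, obsDensity, dif_neg (by simpa using hne)] at h1
  exact (div_pos ((hA1 u).2 z) (jacobianVolume_pos M.g_diffeo z)).ne' h1

theorem Matches.density_eq {M M' : Model n d U} (h : M.Matches M')
    {T : (Fin n → ℝ) → (Fin n → ℝ)} (hT : ∀ z, M'.g (T z) = M.g z) (u : U) (z : Fin n → ℝ) :
    M'.p u (T z) = M.p u z * (jacobianVolume M'.g (T z) / jacobianVolume M.g z) := by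
  have h1 := h u (M.g z) ⟨z, rfl⟩
  rw [obsDensity_apply, ← hT, obsDensity_apply] at h1
  have h2 := (jacobianVolume_pos M.g_diffeo z).ne'
  have h3 := (jacobianVolume_pos M'.g_diffeo (T z)).ne'
  field_simp at h1 ⊢
  linarith

theorem contDiff_logp {M : Model n d U} (hA1 : M.A1) (u : U) : ContDiff ℝ 2 (M.logp u) :=
  (hA1 u).1.log fun z => ((hA1 u).2 z).ne'

/-- Conditional independence makes the log-density locally separable, wherever the density is
positive and continuous. -/
theorem eventually_logp_separable (M : Model n d U) {u : U} {s : Set (Fin n → ℝ)} (hs : IsOpen s)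
    (hcont : ∀ y ∈ s, ContinuousAt (M.p u) y) (hpos : ∀ y ∈ s, 0 < M.p u y) {k l : Fin n}
    (hkl : k ≠ l) (hadj : ¬ M.markovNetwork.Adj k l) {x : Fin n → ℝ} (hx : x ∈ s) :
    ∀ᶠ q : ℝ × ℝ in 𝓝 0,
      M.logp u (x + q.1 • Pi.single k 1 + q.2 • Pi.single l 1) + M.logp u x =
        M.logp u (x + q.1 • Pi.single k 1) + M.logp u (x + q.2 • Pi.single l 1) := by
  have hind : M.CondIndepGiven u k l {k, l}ᶜ := by
    by_contra h
    exact hadj ⟨hkl, fun h' => h (h' u)⟩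
  have hnear : ∀ f : ℝ × ℝ → (Fin n → ℝ), Continuous f → f 0 = x → ∀ᶠ q in 𝓝 0, f q ∈ s :=
    fun f hf h0 => hf.continuousAt.eventually_mem (hs.mem_nhds (h0 ▸ hx))
  filter_upwards [hnear (fun q => x + q.1 • Pi.single k 1 + q.2 • Pi.single l 1) (by fun_prop)
      (by simp), hnear (fun q => x + q.1 • Pi.single k 1) (by fun_prop) (by simp),
    hnear (fun q => x + q.2 • Pi.single l 1) (by fun_prop) (by simp)] with q h11 h10 h01
  have := CondIndepFun.density_corners_eq (M.law_eq u) (M.p_nonneg u) hind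
    (c₀₀ := x) (c₁₀ := x + q.1 • Pi.single k 1) (c₀₁ := x + q.2 • Pi.single l 1)
    (c₁₁ := x + q.1 • Pi.single k 1 + q.2 • Pi.single l 1)
    (fun a ha => by simp [ha]) (fun a ha => by simp [ha])
    (fun a ha => by simp [ha]) (fun a ha => by simp [ha]) hkl
    (hcont _ hx) (hcont _ h10) (hcont _ h01) (hcont _ h11)
  rw [logp, logp, logp, logp, ← Real.log_mul (hpos _ h11).ne' (hpos _ hx).ne',
    ← Real.log_mul (hpos _ h10).ne' (hpos _ h01).ne', mul_comm, this]

theorem partialDeriv_logp_eq_zero {M : Model n d U} (hA1 : M.A1) (u : U) {i j : Fin n}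
    (hij : i ≠ j) (hadj : ¬ M.markovNetwork.Adj i j) (z : Fin n → ℝ) :
    partialDeriv i (partialDeriv j (M.logp u)) z = 0 :=
  partialDeriv_partialDeriv_eq_zero_of_separable (contDiff_logp hA1 u).contDiffAt
    (M.eventually_logp_separable isOpen_univ (fun _ _ => (hA1 u).1.continuous.continuousAt)
      (fun y _ => (hA1 u).2 y) hij hadj (Set.mem_univ z))

variable {M M' : Model n d U} {T φ : (Fin n → ℝ) → (Fin n → ℝ)}

/-- Differences of log-densities between domains, pulled back to the estimated latent variables,
have vanishing mixed derivatives along the non-edges of the estimated Markov network. -/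
theorem Matches.partialDeriv_logp_sub_comp_eq_zero (h : M.Matches M') (hA1 : M.A1)
    (hT : ∀ z, M'.g (T z) = M.g z) (hTo : IsOpen (Set.range T)) (hφ : Function.LeftInverse φ T)
    (hφs : ∀ y ∈ Set.range T, ContDiffAt ℝ 2 φ y) {k l : Fin n} (hkl : k ≠ l)
    (hadj : ¬ M'.markovNetwork.Adj k l) (u u₀ : U) (z : Fin n → ℝ) :
    partialDeriv k (partialDeriv l fun y => M.logp u (φ y) - M.logp u₀ (φ y)) (T z) = 0 := by
  have hp : ∀ u, ∀ y ∈ Set.range T, M'.p u y =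
      M.p u (φ y) * (jacobianVolume M'.g y / jacobianVolume M.g (φ y)) := by
    rintro u _ ⟨x, rfl⟩
    rw [h.density_eq hT, hφ]
  have hratio : ∀ y, 0 < jacobianVolume M'.g y / jacobianVolume M.g (φ y) := fun y =>
    div_pos (jacobianVolume_pos M'.g_diffeo _) (jacobianVolume_pos M.g_diffeo _)
  have hpos : ∀ u, ∀ y ∈ Set.range T, 0 < M'.p u y := fun u y hy => by
    rw [hp u y hy]
    exact mul_pos ((hA1 u).2 _) (hratio y)
  have hcont : ∀ u, ∀ y ∈ Set.range T, ContinuousAt (M'.p u) y := by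
    intro u y hy
    have hφc : ContinuousAt φ y := (hφs y hy).continuousAt
    have : ContinuousAt (fun y => M.p u (φ y) *
        (jacobianVolume M'.g y / jacobianVolume M.g (φ y))) y :=
      ((hA1 u).1.continuous.continuousAt.comp hφc).mul
        ((continuous_jacobianVolume M'.g_diffeo).continuousAt.div
          ((continuous_jacobianVolume M.g_diffeo).continuousAt.comp hφc)
          (jacobianVolume_pos M.g_diffeo _).ne')
    refine this.congr ?_
    filter_upwards [hTo.mem_nhds hy] with x hx using (hp u x hx).symm
  -- The Jacobian ratio, which is not assumed `C²`, drops out; the left-hand side is `C²` on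
  -- `Set.range T`.
  have hlog : ∀ y ∈ Set.range T, M.logp u (φ y) - M.logp u₀ (φ y) =
      M'.logp u y - M'.logp u₀ y := by
    intro y hy
    rw [logp, logp, logp, logp, hp u y hy, hp u₀ y hy,
      Real.log_mul ((hA1 u).2 _).ne' (hratio y).ne', Real.log_mul ((hA1 u₀).2 _).ne' (hratio y).ne']
    ring
  have hz : T z ∈ Set.range T := ⟨z, rfl⟩
  have hnear : ∀ f : ℝ × ℝ → (Fin n → ℝ), Continuous f → f 0 = T z →
      ∀ᶠ q in 𝓝 0, f q ∈ Set.range T :=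
    fun f hf h0 => hf.continuousAt.eventually_mem (hTo.mem_nhds (h0 ▸ hz))
  refine partialDeriv_partialDeriv_eq_zero_of_separable
    (((contDiff_logp hA1 u).contDiffAt.comp _ (hφs _ hz)).sub
      ((contDiff_logp hA1 u₀).contDiffAt.comp _ (hφs _ hz))) ?_
  filter_upwards [hnear (fun q => T z + q.1 • Pi.single k 1 + q.2 • Pi.single l 1) (by fun_prop)
      (by simp), hnear (fun q => T z + q.1 • Pi.single k 1) (by fun_prop) (by simp),
    hnear (fun q => T z + q.2 • Pi.single l 1) (by fun_prop) (by simp),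
    M'.eventually_logp_separable hTo (hcont u) (hpos u) hkl hadj hz,
    M'.eventually_logp_separable hTo (hcont u₀) (hpos u₀) hkl hadj hz] with q h11 h10 h01 e e₀
  simp only [Function.comp_apply]
  rw [hlog _ h11, hlog _ h10, hlog _ h01, hlog _ hz]
  linarith

theorem A2.jacobian_products_eq_zero (hA2 : M.A2) (h : M.Matches M') (hA1 : M.A1)
    (hT : ∀ z, M'.g (T z) = M.g z) (hTo : IsOpen (Set.range T)) (hφ : Function.LeftInverse φ T)
    (hφs : ∀ y ∈ Set.range T, ContDiffAt ℝ 2 φ y) {k l : Fin n} (hkl : k ≠ l)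
    (hadj : ¬ M'.markovNetwork.Adj k l) (z : Fin n → ℝ) :
    (∀ i, partialDeriv k (fun y => φ y i) (T z) * partialDeriv l (fun y => φ y i) (T z) = 0) ∧
      ∀ i j, M.markovNetwork.Adj i j →
        partialDeriv k (fun y => φ y i) (T z) * partialDeriv l (fun y => φ y j) (T z) +
        partialDeriv k (fun y => φ y j) (T z) * partialDeriv l (fun y => φ y i) (T z) = 0 := by
  classical
  obtain ⟨s, hs⟩ := hA2 z
  set a : Fin n → ℝ := fun i => partialDeriv k (fun y => φ y i) (T z) with ha
  set b : Fin n → ℝ := fun i => partialDeriv l (fun y => φ y i) (T z) with hb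
  set r : Fin n → ℝ := fun i => partialDeriv k (partialDeriv l fun y => φ y i) (T z) with hr
  -- These are the chain-rule coefficients of the first, pure second and edge derivatives; only the
  -- vanishing of the last two blocks is used later.
  set c : Fin n ⊕ Fin n ⊕ {e : Fin n × Fin n // e.1 < e.2 ∧ M.markovNetwork.Adj e.1 e.2} → ℝ :=
    Sum.elim r (Sum.elim (fun i => a i * b i)
      fun e => a e.1.1 * b e.1.2 + a e.1.2 * b e.1.1) with hc
  have hdot : ∀ u u₀, c ⬝ᵥ (M.w u z - M.w u₀ z) = 0 := by
    intro u u₀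
    have hl := contDiff_logp hA1 u
    have hl₀ := contDiff_logp hA1 u₀
    have hD : ContDiff ℝ 2 fun x => M.logp u x - M.logp u₀ x := hl.sub hl₀
    have hfirst : ∀ i, partialDeriv i (fun x => M.logp u x - M.logp u₀ x) =
        fun x => partialDeriv i (M.logp u) x - partialDeriv i (M.logp u₀) x := fun i => funext fun x =>
      partialDeriv_sub (hl.differentiable (by norm_num) x) (hl₀.differentiable (by norm_num) x) i
    have hsecond : ∀ i j x, partialDeriv i (partialDeriv j fun x => M.logp u x - M.logp u₀ x) x =
        partialDeriv i (partialDeriv j (M.logp u)) x -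
          partialDeriv i (partialDeriv j (M.logp u₀)) x := by
      intro i j x
      rw [hfirst]
      exact partialDeriv_sub
        ((contDiffAt_partialDeriv hl.contDiffAt j).differentiableAt (by norm_num))
        ((contDiffAt_partialDeriv hl₀.contDiffAt j).differentiableAt (by norm_num)) i
    have hchain := partialDeriv_partialDeriv_comp hD (hφs (T z) ⟨z, rfl⟩) k l
    rw [h.partialDeriv_logp_sub_comp_eq_zero hA1 hT hTo hφ hφs hkl hadj, Finset.sum_add_distrib,
      sum_quadratic_eq_sum_edges (G := M.markovNetwork)
        (S := fun j i => partialDeriv j (partialDeriv i fun x => M.logp u x - M.logp u₀ x) (φ (T z)))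
        (fun i j => partialDeriv_comm hD.contDiffAt i j)
        (fun i j hij hG => by
          rw [hsecond, partialDeriv_logp_eq_zero hA1 u hij hG,
            partialDeriv_logp_eq_zero hA1 u₀ hij hG, sub_zero]) a b] at hchain
    rw [hφ z] at hchain
    simp only [hsecond] at hchain
    simp only [hfirst] at hchain
    rw [hchain, dotProduct, Fintype.sum_sum_type, Fintype.sum_sum_type, add_comm]
    simp only [hc, w, Pi.sub_apply, Sum.elim_inl, Sum.elim_inr]
    congr 1
    exact Finset.sum_congr rfl fun i _ => mul_comm _ _
  have hc0 : c = 0 := by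
    refine eq_zero_of_dotProduct_eq_zero hs ?_ fun k => hdot _ _
    have := card_ordered_adj_eq_ncard_edgeSet M.markovNetwork
    rw [Nat.card_eq_fintype_card] at this
    rw [Fintype.card_sum, Fintype.card_sum, this, Fintype.card_fin, Fintype.card_fin,
      LatentSEM.numEdges]
    ring
  refine ⟨fun i => congrFun hc0 (.inr (.inl i)), fun i j hij => ?_⟩
  rcases lt_or_gt_of_ne hij.ne with hlt | hlt
  · exact congrFun hc0 (.inr (.inr ⟨(i, j), hlt, hij⟩))
  · rw [add_comm]
    exact congrFun hc0 (.inr (.inr ⟨(j, i), hlt, hij.symm⟩))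

end Model

end CausalRep

/-! ### The identifiability theorem. -/

theorem mainTheorem2 {n d : ℕ} {U : Type*} (M Mhat : CausalRep.Model n d U)
    (hA1 : M.A1) (hA2 : M.A2) (hmin : M.IsMinimalEstimate Mhat) :
    ∃ Zhat : (Fin n → ℝ) → (Fin n → ℝ),
      (∀ z, Mhat.g (Zhat z) = M.g z) ∧
      ∃ π : Equiv.Perm (Fin n), ∀ i,
        DependsOn (fun z => Zhat z (π i))
          ({i} ∪ CausalRep.intimateNeighbors M.markovNetwork i) ∧
        (∃ (z : Fin n → ℝ) (t : ℝ), Zhat (Function.update z i t) (π i) ≠ Zhat z (π i)) ∧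
        (CausalRep.intimateNeighbors M.markovNetwork i = ∅ →
          ∃ h : ℝ → ℝ, CausalRep.IsC2DiffeoOntoImage h ∧ ∀ z, Zhat z (π i) = h (z i)) := by
  open CausalRep in
  obtain ⟨hmatch, hmin⟩ := hmin
  -- The true model matches itself, hence competes in the minimization.
  have hcard := hmin M fun _ _ _ => rfl
  -- A2 provides at least one domain because its index set has size at least one.
  have : Nonempty U := ⟨(hA2 0).choose 0⟩
  obtain ⟨T, hT, hT2, hTinj, hTd⟩ :=
    M.g_diffeo.exists_transition Mhat.g_diffeo (hmatch.range_subset hA1)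
  obtain ⟨hTo, φ, hφ, hφs⟩ := exists_contDiffAt_leftInverse hT2 hTinj hTd
  have hTk : ∀ k, ContDiff ℝ 2 fun z => T z k := contDiff_pi.1 hT2
  have hTkd : ∀ k, Differentiable ℝ fun z => T z k := fun k => (hTk k).differentiable (by norm_num)
  set A : (Fin n → ℝ) → Matrix (Fin n) (Fin n) ℝ := fun z =>
    Matrix.of fun k i => partialDeriv i (fun z => T z k) z with hA
  set J : (Fin n → ℝ) → Matrix (Fin n) (Fin n) ℝ := fun z =>
    Matrix.of fun i k => partialDeriv k (fun y => φ y i) (T z) with hJ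
  have hAJ : ∀ z, A z * J z = 1 := by
    intro z
    rw [mul_eq_one_comm]
    ext i j
    have hφi := (contDiffAt_pi.1 (hφs (T z) ⟨z, rfl⟩) i).differentiableAt (by norm_num)
    have h1 := partialDeriv_comp hφi (hT2.differentiable (by norm_num) z) j
    rw [Matrix.mul_apply]
    simp only [hA, hJ, Matrix.of_apply]
    rw [← h1]
    simp only [hφ _]
    rw [partialDeriv, (hasFDerivAt_apply i z).fderiv, Matrix.one_apply]
    simp [Pi.single_apply]
  have hdet : ∀ z, (A z).det ≠ 0 := fun z h => by
    have := congrArg Matrix.det (hAJ z)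
    rw [Matrix.det_mul, h, zero_mul, Matrix.det_one] at this
    exact zero_ne_one this
  have hAc : Continuous A := continuous_matrix fun k i => continuous_iff_continuousAt.2 fun z =>
    (contDiffAt_partialDeriv (hTk k).contDiffAt i).continuousAt
  obtain ⟨ρ, hρ, hsub⟩ := exists_perm_of_preconnected (G := M.markovNetwork) hAc hdet fun z =>
    exists_perm_closedNeighbors_subset hcard (hAJ z) fun k l hkl hadj =>
      hA2.jacobian_products_eq_zero hmatch hA1 hT hTo hφ hφs hkl hadj z
  have hzero : ∀ i, ∀ j ∉ {i} ∪ intimateNeighbors M.markovNetwork i, ∀ z,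
      partialDeriv j (fun z => T z (ρ i)) z = 0 := by
    intro i j hj z
    by_contra hne
    exact hj (mem_insert_intimateNeighbors_of_closedNeighbors_subset (hsub z i j hne))
  have hdep : ∀ i, DependsOn (fun z => T z (ρ i)) ({i} ∪ intimateNeighbors M.markovNetwork i) :=
    fun i => dependsOn_of_partialDeriv_eq_zero (hTkd _) (hzero i)
  refine ⟨T, hT, ρ, fun i => ⟨hdep i, ?_, fun hempty => ?_⟩⟩
  · obtain ⟨z, hz⟩ := hρ i
    exact ⟨z, exists_update_ne_of_partialDeriv_ne_zero (hTkd (ρ i) z) hz⟩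
  -- Row `ρ i` of the invertible matrix `A z` can be nonzero only in column `i`.
  · have hne : ∀ z, partialDeriv i (fun z => T z (ρ i)) z ≠ 0 := by
      intro z h0
      refine hdet z (Matrix.det_eq_zero_of_row_eq_zero (ρ i) fun j => ?_)
      by_cases hj : j = i
      · subst hj
        exact h0
      · exact hzero i j (by simp [hempty, hj]) z
    -- Restricting to the `i`-th axis loses nothing, since the other coordinates do not matter.
    refine ⟨fun t => T (t • Pi.single i 1) (ρ i), isC2DiffeoOntoImage_of_deriv_ne_zero
      ((hTk _).comp (contDiff_id.smul contDiff_const)) fun t => ?_, fun z => ?_⟩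
    · have h1 : HasDerivAt (fun t : ℝ => t • (Pi.single i 1 : Fin n → ℝ)) (Pi.single i 1) t := by
        simpa using (hasDerivAt_id t).smul_const (Pi.single i 1 : Fin n → ℝ)
      have h2 := (hTkd (ρ i) (t • Pi.single i 1)).hasFDerivAt.comp_hasDerivAt t h1
      exact h2.deriv.trans_ne (hne _)
    · refine hdep i fun j hj => ?_
      rw [hempty, Set.union_empty] at hj
      rw [Set.mem_singleton_iff.1 hj]
      simp
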